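/- Let $\beta>1$ be irrational and let $T_\beta:[0,1[\,\to[0,1[$, $T_\beta(x)=\beta x-\lfloor\beta x\rfloor$. Put $T_\beta^{0}(1)=1$ and $T_\beta^{n+1}(1)=\beta T_\beta^{n}(1)-\lfloor\beta T_\beta^{n}(1)\rfloor$ for $n\ge 0$. Let \[ h_\beta(x)=\frac1{F(\beta)}\sum_{n\ge 0}\beta^{-n}\,\mathbf 1_{[0,T_\beta^{n}(1)[}(x),\qquad F(\beta)=\sum_{n\ge 0}\beta^{-n}T_\beta^{n}(1), \] and let the Parry measure $\mu_\beta$ be the measure on $[0,1[$ with density $h_\beta$ with respect to Lebesgue measure. Let \[ P_\beta f(x)=\frac1\beta\sum_{a=0}^{\lfloor\beta\rfloor} f\!\left(\frac{x+a}{\beta}\right)\mathbf 1_{[0,1[}\!\left(\frac{x+a}{\beta}\right) \] be the Perron–Frobenius (transfer) operator of $T_\beta$. Then both series converge (the first one for every $x$), $\mu_\beta$ is a probability measure, and: 1. $P_\beta h_\beta(x)=h_\beta(x)$ for every $x\in[0,1[$; 2. $\mu_\beta$ is $T_\beta$-invariant; 3. $T_\beta$ is exact with respect to $\mu_\beta$,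 that is, $T_\beta$ preserves $\mu_\beta$ and every set $A\in\bigcap_{n\ge0}T_\beta^{-n}\mathscr B$, where $\mathscr B$ is the Borel $\sigma$-algebra of $[0,1[$, satisfies $\mu_\beta(A)=0$ or $\mu_\beta([0,1[\,\setminus A)=0$; 4. $T_\beta$ is ergodic with respect to $\mu_\beta$. -/

import Mathlib

open MeasureTheory

noncomputable section

namespace BetaTransformation

/-- The formula `x ↦ β x - ⌊β x⌋` on the real line. It is needed outside `[0,1[` only to start an
orbit at the point `1`. -/
def betaMap (β x : ℝ) : ℝ := β * x - (⌊β * x⌋ : ℝ)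

theorem betaMap_mem (β x : ℝ) : betaMap β x ∈ Set.Ico (0 : ℝ) 1 :=
  ⟨Int.fract_nonneg (β * x), Int.fract_lt_one (β * x)⟩

/-- The `β`-transformation `T_β : [0,1[ → [0,1[`. -/
def T (β : ℝ) (x : Set.Ico (0 : ℝ) 1) : Set.Ico (0 : ℝ) 1 :=
  ⟨betaMap β x, betaMap_mem β x⟩

/-- The point `T_β^n(1)`; for `n = 0` it is `1`. -/
def orbitOne (β : ℝ) (n : ℕ) : ℝ := (betaMap β)^[n] 1

/-- The `n`-th term `β^{-n} 1_{[0, T_β^n(1)[}(x)` of the Parry series. -/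
def parryTerm (β x : ℝ) (n : ℕ) : ℝ :=
  (β ^ n)⁻¹ * (Set.Ico (0 : ℝ) (orbitOne β n)).indicator (fun _ => (1 : ℝ)) x

/-- The normalizing constant `F(β) = ∑_{n ≥ 0} β^{-n} T_β^n(1)`. -/
def parryConst (β : ℝ) : ℝ := ∑' n : ℕ, (β ^ n)⁻¹ * orbitOne β n

/-- The Parry density `h_β`. -/
def parryDensity (β x : ℝ) : ℝ := (1 / parryConst β) * ∑' n : ℕ, parryTerm β x n

/-- The Parry measure `μ_β` on `[0,1[`: density `h_β` with respect to Lebesgue measure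
(the restriction of `volume` to the subtype). -/
def parryMeasure (β : ℝ) : Measure (Set.Ico (0 : ℝ) 1) :=
  ((volume : Measure ℝ).comap (Subtype.val : Set.Ico (0 : ℝ) 1 → ℝ)).withDensity
    (fun x => ENNReal.ofReal (parryDensity β (x : ℝ)))

/-- The Perron–Frobenius (transfer) operator of `T_β`,
`P_β f (x) = (1/β) ∑_{a=0}^{⌊β⌋} f((x+a)/β) 1_{[0,1[}((x+a)/β)`. -/
def perronFrobenius (β : ℝ) (f : ℝ → ℝ) (x : ℝ) : ℝ :=
  (1 / β) * ∑ a ∈ Finset.range (⌊β⌋₊ + 1),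
    f ((x + (a : ℝ)) / β) *
      (Set.Ico (0 : ℝ) 1).indicator (fun _ => (1 : ℝ)) ((x + (a : ℝ)) / β)

/-- The tail σ-algebra `⋂ₙ S^{-n} 𝓐` of a self-map `S` of a measurable space `(α, 𝓐)`. -/
abbrev tailSigmaAlgebra {α : Type*} [m : MeasurableSpace α] (S : α → α) : MeasurableSpace α :=
  ⨅ n : ℕ, MeasurableSpace.comap (S^[n]) m

/-- A map `S` is exact with respect to `μ` if it preserves `μ` and its tail σ-algebra is
trivial: each of its sets is null or has null complement. -/
structure IsExact {α : Type*} [MeasurableSpace α] (S : α → α) (μ : Measure α) : Prop where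
  measurePreserving : MeasurePreserving S μ μ
  tail_trivial : ∀ A : Set α, MeasurableSet[tailSigmaAlgebra S] A → μ A = 0 ∨ μ Aᶜ = 0

end BetaTransformation

end

namespace BetaTransformation

open Filter Topology

/-! Invariance: the transfer operator sends the indicator of `[0,t[` to `β⁻¹(⌊βt⌋ + 1_{[0,{βt}[})`,
so it sends the `n`-th Parry term to the `(n+1)`-st plus the constant `dₙ β^{-n-1}`, where `dₙ = ⌊β
T^n(1)⌋`. These constants add up to `1`, the β-expansion of `1`, which restores the missing zeroth
term. Hence `h_β` is fixed (`perronFrobenius_parryDensity`), and a change of variables turns this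
into invariance of `μ_β`.

Exactness: every point lies in arbitrarily short intervals that some `T^n` maps affinely onto
`[0,1[` (`exists_fullCylinder_ge`). Let `A = T^{-n} Bₙ` for all `n`, with positive Lebesgue measure.
Around a density point of `A`, the relative measure of `A` in these intervals tends to `1`, and
affinity carries this over to `Bₙ`. Invariance and boundedness of `h_β` give `μ_β(Aᶜ) = μ_β(Bₙᶜ) ≤ C
(1 - |Bₙ|)`, which tends to `0` along these ranks. Ergodicity follows. -/

theorem orbitOne_zero (β : ℝ) : orbitOne β 0 = 1 := rfl

theorem orbitOne_succ (β : ℝ) (n : ℕ) : orbitOne β (n + 1) = betaMap β (orbitOne β n) :=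
  Function.iterate_succ_apply' _ _ _

theorem orbitOne_mem_Icc (β : ℝ) (n : ℕ) : orbitOne β n ∈ Set.Icc (0 : ℝ) 1 := by
  cases n with
  | zero => simp [orbitOne_zero]
  | succ n =>
    rw [orbitOne_succ]
    exact Set.Ico_subset_Icc_self (betaMap_mem β _)

theorem coe_T_iterate (β : ℝ) (n : ℕ) (x : Set.Ico (0 : ℝ) 1) :
    ((T β)^[n] x : ℝ) = (betaMap β)^[n] x := by
  induction n with
  | zero => rfl
  | succ n ih =>
    rw [Function.iterate_succ_apply', Function.iterate_succ_apply', ← ih]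
    rfl

theorem measurable_betaMap (β : ℝ) : Measurable (betaMap β) := by
  unfold betaMap
  fun_prop

theorem measurable_T (β : ℝ) : Measurable (T β) :=
  ((measurable_betaMap β).comp measurable_subtype_coe).subtype_mk

/-! ### Convergence of the Parry series and normalization -/

section Series

variable {β : ℝ}

theorem summable_inv_pow (hβ : 1 < β) : Summable fun n : ℕ => (β ^ n)⁻¹ := by
  simp_rw [← inv_pow]
  exact summable_geometric_of_lt_one (by positivity) (inv_lt_one_of_one_lt₀ hβ)

theorem tendsto_inv_pow (hβ : 1 < β) : Tendsto (fun n : ℕ => (β ^ n)⁻¹) atTop (𝓝 0) :=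
  (summable_inv_pow hβ).tendsto_atTop_zero

theorem inv_pow_mul_orbitOne_nonneg (hβ : 1 < β) (n : ℕ) : 0 ≤ (β ^ n)⁻¹ * orbitOne β n :=
  mul_nonneg (by positivity) (orbitOne_mem_Icc β n).1

theorem summable_inv_pow_mul_orbitOne (hβ : 1 < β) :
    Summable fun n : ℕ => (β ^ n)⁻¹ * orbitOne β n :=
  (summable_inv_pow hβ).of_nonneg_of_le (inv_pow_mul_orbitOne_nonneg hβ) fun n =>
    mul_le_of_le_one_right (by positivity) (orbitOne_mem_Icc β n).2

theorem parryTerm_nonneg (hβ : 1 < β) (x : ℝ) (n : ℕ) : 0 ≤ parryTerm β x n :=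
  mul_nonneg (by positivity) (Set.indicator_nonneg (by simp) _)

theorem parryTerm_le (hβ : 1 < β) (x : ℝ) (n : ℕ) : parryTerm β x n ≤ (β ^ n)⁻¹ :=
  mul_le_of_le_one_right (by positivity)
    (Set.indicator_le' (fun _ _ => le_rfl) (fun _ _ => zero_le_one) x)

theorem summable_parryTerm (hβ : 1 < β) (x : ℝ) : Summable (parryTerm β x) :=
  (summable_inv_pow hβ).of_nonneg_of_le (parryTerm_nonneg hβ x) (parryTerm_le hβ x)

theorem parryConst_pos (hβ : 1 < β) : 0 < parryConst β :=
  (summable_inv_pow_mul_orbitOne hβ).tsum_pos (inv_pow_mul_orbitOne_nonneg hβ) 0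
    (by simp [orbitOne_zero])

theorem parryDensity_nonneg (hβ : 1 < β) (x : ℝ) : 0 ≤ parryDensity β x :=
  mul_nonneg (one_div_nonneg.2 (parryConst_pos hβ).le) (tsum_nonneg (parryTerm_nonneg hβ x))

theorem parryDensity_le (hβ : 1 < β) (x : ℝ) :
    parryDensity β x ≤ 1 / parryConst β * ∑' n : ℕ, (β ^ n)⁻¹ :=
  mul_le_mul_of_nonneg_left
    ((summable_parryTerm hβ x).tsum_le_tsum (parryTerm_le hβ x) (summable_inv_pow hβ))
    (one_div_nonneg.2 (parryConst_pos hβ).le)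

theorem measurable_parryTerm (β : ℝ) (n : ℕ) : Measurable fun x => parryTerm β x n :=
  (measurable_const.indicator measurableSet_Ico).const_mul _

theorem ofReal_parryDensity (hβ : 1 < β) (x : ℝ) :
    ENNReal.ofReal (parryDensity β x) =
      ENNReal.ofReal (1 / parryConst β) * ∑' n, ENNReal.ofReal (parryTerm β x n) := by
  rw [parryDensity, ENNReal.ofReal_mul (one_div_nonneg.2 (parryConst_pos hβ).le),
    ENNReal.ofReal_tsum_of_nonneg (parryTerm_nonneg hβ x) (summable_parryTerm hβ x)]

theorem measurable_ofReal_parryDensity (hβ : 1 < β) :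
    Measurable fun x => ENNReal.ofReal (parryDensity β x) := by
  simp_rw [ofReal_parryDensity hβ]
  exact (Measurable.tsum fun n => (measurable_parryTerm β n).ennreal_ofReal).const_mul _

theorem lintegral_parryTerm (hβ : 1 < β) (n : ℕ) :
    ∫⁻ x in Set.Ico (0 : ℝ) 1, ENNReal.ofReal (parryTerm β x n) =
      ENNReal.ofReal ((β ^ n)⁻¹ * orbitOne β n) := by
  have h0 : (0 : ℝ) ≤ (β ^ n)⁻¹ := by positivity
  have h : ∀ x, ENNReal.ofReal (parryTerm β x n) =
      (Set.Ico (0 : ℝ) (orbitOne β n)).indicator (fun _ => ENNReal.ofReal (β ^ n)⁻¹) x := by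
    intro x
    by_cases hx : x ∈ Set.Ico (0 : ℝ) (orbitOne β n) <;> simp [parryTerm, hx]
  simp_rw [h]
  rw [lintegral_indicator_const measurableSet_Ico, Measure.restrict_apply measurableSet_Ico,
    Set.inter_eq_left.2 (Set.Ico_subset_Ico_right (orbitOne_mem_Icc β n).2), Real.volume_Ico,
    sub_zero, ENNReal.ofReal_mul h0]

theorem lintegral_parryDensity (hβ : 1 < β) :
    ∫⁻ x in Set.Ico (0 : ℝ) 1, ENNReal.ofReal (parryDensity β x) = 1 := by
  have hF := parryConst_pos hβ
  simp_rw [ofReal_parryDensity hβ]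
  rw [lintegral_const_mul' _ _ ENNReal.ofReal_ne_top,
    lintegral_tsum fun n => (measurable_parryTerm β n).ennreal_ofReal.aemeasurable]
  simp_rw [lintegral_parryTerm hβ]
  rw [← ENNReal.ofReal_tsum_of_nonneg (inv_pow_mul_orbitOne_nonneg hβ)
    (summable_inv_pow_mul_orbitOne hβ), ← parryConst,
    ← ENNReal.ofReal_mul (one_div_nonneg.2 hF.le), one_div_mul_cancel hF.ne', ENNReal.ofReal_one]

theorem isProbabilityMeasure_parryMeasure (hβ : 1 < β) :
    IsProbabilityMeasure (parryMeasure β) := by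
  constructor
  rw [parryMeasure, withDensity_apply _ MeasurableSet.univ, Measure.restrict_univ,
    lintegral_subtype_comap measurableSet_Ico (fun x : ℝ => ENNReal.ofReal (parryDensity β x)),
    lintegral_parryDensity hβ]

end Series

/-! ### The Parry density as a fixed point of the transfer operator -/

section TransferOperator

variable {β : ℝ}

/-- The transfer operator maps the indicator of `[0, t[` to a constant plus a multiple of the
indicator of `[0, {β t}[`. -/
theorem perronFrobenius_indicator_Ico (hβ : 1 < β) {t : ℝ} (ht : t ∈ Set.Icc (0 : ℝ) 1) {x : ℝ}
    (hx : x ∈ Set.Ico (0 : ℝ) 1) :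
    perronFrobenius β ((Set.Ico 0 t).indicator fun _ => 1) x =
      (1 / β) * ((⌊β * t⌋ : ℝ) + (Set.Ico 0 (betaMap β t)).indicator (fun _ => 1) x) := by
  obtain ⟨hx0, hx1⟩ := hx
  obtain ⟨ht0, ht1⟩ := ht
  have hβ0 : 0 < β := by linarith
  have hm0 : 0 ≤ β * t := by positivity
  have hmle : ⌊β * t⌋₊ ≤ ⌊β⌋₊ := Nat.floor_le_floor (by nlinarith)
  have hfl : (⌊β * t⌋ : ℝ) = (⌊β * t⌋₊ : ℝ) := (natCast_floor_eq_intCast_floor hm0).symm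
  have h1 := Nat.floor_le hm0
  have h2 := Nat.lt_floor_add_one (β * t)
  have hterm : ∀ a : ℕ, (Set.Ico 0 t).indicator (fun _ => (1 : ℝ)) ((x + a) / β) *
      (Set.Ico (0 : ℝ) 1).indicator (fun _ => (1 : ℝ)) ((x + a) / β) =
      if x + a < β * t then 1 else 0 := by
    intro a
    have h0 : 0 ≤ (x + a) / β := by positivity
    have hlt : (x + a) / β < t ↔ x + a < β * t := by rw [div_lt_iff₀ hβ0, mul_comm]
    by_cases h : (x + a) / β < t
    · simp [h0, h, h.trans_le ht1, hlt.1 h]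
    · simp [h, mt hlt.2 h]
  rw [perronFrobenius, Finset.sum_congr rfl fun a _ => hterm a, Finset.sum_boole]
  congr 1
  unfold betaMap
  rw [hfl]
  -- The sum counts the integers `a ≥ 0` with `a < βt - x`: there are `⌊βt⌋ + 1` of them if `x <
  -- {βt}`, and `⌊βt⌋` otherwise.
  by_cases h : x < β * t - ⌊β * t⌋₊
  · have : (Finset.range (⌊β⌋₊ + 1)).filter (fun a : ℕ => x + a < β * t) =
        Finset.range (⌊β * t⌋₊ + 1) := by
      ext a
      simp only [Finset.mem_filter, Finset.mem_range, Nat.lt_succ_iff]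
      constructor
      · rintro ⟨-, ha⟩
        exact Nat.le_floor (by linarith)
      · intro ha
        have : (a : ℝ) ≤ ⌊β * t⌋₊ := by exact_mod_cast ha
        exact ⟨ha.trans hmle, by linarith⟩
    rw [this, Set.indicator_of_mem (by exact ⟨hx0, h⟩)]
    simp
  · have : (Finset.range (⌊β⌋₊ + 1)).filter (fun a : ℕ => x + a < β * t) =
        Finset.range ⌊β * t⌋₊ := by
      ext a
      simp only [Finset.mem_filter, Finset.mem_range]
      constructor
      · rintro ⟨-, ha⟩
        have : (a : ℝ) < ⌊β * t⌋₊ := by linarith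
        exact_mod_cast this
      · intro ha
        have : (a : ℝ) + 1 ≤ ⌊β * t⌋₊ := by exact_mod_cast ha
        exact ⟨by omega, by linarith⟩
    rw [this, Set.indicator_of_notMem (fun h' => h h'.2)]
    simp

theorem perronFrobenius_parryTerm (hβ : 1 < β) {x : ℝ} (hx : x ∈ Set.Ico (0 : ℝ) 1) (n : ℕ) :
    perronFrobenius β (fun y => parryTerm β y n) x =
      (β ^ (n + 1))⁻¹ * (⌊β * orbitOne β n⌋ : ℝ) + parryTerm β x (n + 1) := by
  have hβ0 : β ≠ 0 := by positivity
  have h : perronFrobenius β (fun y => parryTerm β y n) x =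
      (β ^ n)⁻¹ * perronFrobenius β ((Set.Ico 0 (orbitOne β n)).indicator fun _ => 1) x := by
    unfold perronFrobenius parryTerm
    simp_rw [mul_assoc, ← Finset.mul_sum]
    rw [mul_left_comm]
  rw [h, perronFrobenius_indicator_Ico hβ (orbitOne_mem_Icc β n) hx, parryTerm, orbitOne_succ,
    pow_succ]
  field_simp

/-- The greedy expansion `1 = ∑ dₙ β^{-n-1}` with digits `dₙ = ⌊β T^n(1)⌋`. -/
theorem hasSum_digits (hβ : 1 < β) :
    HasSum (fun n : ℕ => (β ^ (n + 1))⁻¹ * (⌊β * orbitOne β n⌋ : ℝ)) 1 := by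
  have hβ0 : 0 < β := by linarith
  -- The sum telescopes, since `dₙ = β T^n(1) - T^{n+1}(1)`.
  have hpart : ∀ N : ℕ, ∑ n ∈ Finset.range N, (β ^ (n + 1))⁻¹ * (⌊β * orbitOne β n⌋ : ℝ) =
      1 - (β ^ N)⁻¹ * orbitOne β N := by
    intro N
    induction N with
    | zero => simp [orbitOne_zero]
    | succ N ih =>
      rw [Finset.sum_range_succ, ih, orbitOne_succ, betaMap, pow_succ]
      field_simp
      ring
  rw [hasSum_iff_tendsto_nat_of_nonneg]
  · simp_rw [hpart]
    simpa using (summable_inv_pow_mul_orbitOne hβ).tendsto_atTop_zero.const_sub 1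
  · intro n
    have : (0 : ℤ) ≤ ⌊β * orbitOne β n⌋ :=
      Int.floor_nonneg.2 (mul_nonneg hβ0.le (orbitOne_mem_Icc β n).1)
    have : (0 : ℝ) ≤ ⌊β * orbitOne β n⌋ := by exact_mod_cast this
    positivity

theorem perronFrobenius_parryDensity (hβ : 1 < β) {x : ℝ} (hx : x ∈ Set.Ico (0 : ℝ) 1) :
    perronFrobenius β (parryDensity β) x = parryDensity β x := by
  have hsum : HasSum (fun n => perronFrobenius β (fun y => parryTerm β y n) x)
      (perronFrobenius β (fun y => ∑' n, parryTerm β y n) x) :=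
    (hasSum_sum fun a _ => ((summable_parryTerm hβ _).hasSum.mul_right _)).mul_left _
  have hsum' : HasSum (fun n => perronFrobenius β (fun y => parryTerm β y n) x)
      (∑' n, parryTerm β x n) := by
    simp_rw [perronFrobenius_parryTerm hβ hx]
    -- The zeroth term equals `1`, exactly the sum of the constants produced by the digits.
    have h0 : parryTerm β x 0 = 1 := by simp [parryTerm, orbitOne_zero, hx.1, hx.2]
    rw [(summable_parryTerm hβ x).tsum_eq_zero_add, h0]
    exact (hasSum_digits hβ).add ((summable_nat_add_iff 1).2 (summable_parryTerm hβ x)).hasSum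
  have hlin : perronFrobenius β (parryDensity β) x =
      1 / parryConst β * perronFrobenius β (fun y => ∑' n, parryTerm β y n) x := by
    unfold perronFrobenius parryDensity
    simp_rw [mul_assoc, ← Finset.mul_sum]
    rw [mul_left_comm]
  rw [hlin, hsum.unique hsum', parryDensity]

end TransferOperator

/-! ### Full cylinders -/

section FullCylinders

variable {β : ℝ}

/-- The interval `[l, l + β^{-n}[` is a full cylinder of rank `n`: it lies in `[0,1[`, and `T_β^n`
maps it affinely onto `[0,1[`. -/
structure IsFullCylinder (β : ℝ) (n : ℕ) (l : ℝ) : Prop where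
  nonneg : 0 ≤ l
  add_le_one : l + (β ^ n)⁻¹ ≤ 1
  iterate_eq : ∀ y ∈ Set.Ico l (l + (β ^ n)⁻¹), (betaMap β)^[n] y = β ^ n * (y - l)

theorem pow_mul_sub_mem_Ico (hβ : 1 < β) {n : ℕ} {l y : ℝ}
    (hy : y ∈ Set.Ico l (l + (β ^ n)⁻¹)) : β ^ n * (y - l) ∈ Set.Ico (0 : ℝ) 1 := by
  have hp : 0 < β ^ n := by positivity
  refine ⟨mul_nonneg hp.le (sub_nonneg.2 hy.1), ?_⟩
  rw [← mul_inv_cancel₀ hp.ne']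
  exact mul_lt_mul_of_pos_left (by linarith [hy.2]) hp

theorem IsFullCylinder.comp (hβ : 1 < β) {m n : ℕ} {l k : ℝ} (hl : IsFullCylinder β n l)
    (hk : IsFullCylinder β m k) : IsFullCylinder β (m + n) (l + (β ^ n)⁻¹ * k) := by
  have hp : 0 < β ^ n := by positivity
  have hq : 0 < β ^ m := by positivity
  have hend : l + (β ^ n)⁻¹ * k + (β ^ (m + n))⁻¹ = l + (β ^ n)⁻¹ * (k + (β ^ m)⁻¹) := by
    rw [pow_add]
    field_simp
    ring
  have hle : (β ^ n)⁻¹ * (k + (β ^ m)⁻¹) ≤ (β ^ n)⁻¹ :=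
    mul_le_of_le_one_right (by positivity) hk.add_le_one
  have hk0 : 0 ≤ (β ^ n)⁻¹ * k := mul_nonneg (by positivity) hk.nonneg
  refine ⟨add_nonneg hl.nonneg hk0, by linarith [hl.add_le_one], fun y hy => ?_⟩
  rw [hend] at hy
  obtain ⟨hy1, hy2⟩ := hy
  rw [Function.iterate_add_apply, hl.iterate_eq y ⟨by linarith, by linarith⟩,
    hk.iterate_eq _ ⟨?_, ?_⟩, pow_add]
  · field_simp
    ring
  · have : (β ^ n)⁻¹ * k ≤ y - l := by linarith
    rwa [inv_mul_le_iff₀ hp] at this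
  · have : y - l < (β ^ n)⁻¹ * (k + (β ^ m)⁻¹) := by linarith
    rwa [lt_inv_mul_iff₀ hp] at this

/-- The last cylinder of rank `n`, on which `T_β^n` is a translate of `T_β^n(1)`. -/
theorem betaMap_iterate_eq_of_near_one (hβ : 1 < β) (n : ℕ) {y : ℝ}
    (hy : 1 - (β ^ n)⁻¹ * orbitOne β n ≤ y) (hy1 : y < 1) :
    (betaMap β)^[n] y = orbitOne β n - β ^ n * (1 - y) := by
  have hβ0 : 0 < β := by linarith
  induction n with
  | zero => simp [orbitOne_zero]
  | succ n ih =>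
    have hp : 0 < β ^ n := by positivity
    have hq : 0 < β ^ (n + 1) := by positivity
    have hfl : (0 : ℝ) ≤ ⌊β * orbitOne β n⌋ := by
      exact_mod_cast Int.floor_nonneg.2 (mul_nonneg hβ0.le (orbitOne_mem_Icc β n).1)
    have hy' : β ^ (n + 1) * (1 - y) ≤ orbitOne β (n + 1) := by
      rw [← le_inv_mul_iff₀ hq]
      linarith
    have hpos : 0 < β ^ (n + 1) * (1 - y) := mul_pos hq (by linarith)
    have hyn : 1 - (β ^ n)⁻¹ * orbitOne β n ≤ y := by
      have : 1 - y ≤ (β ^ n)⁻¹ * orbitOne β n := by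
        rw [le_inv_mul_iff₀ hp]
        rw [orbitOne_succ, betaMap, pow_succ] at hy'
        have : β * (β ^ n * (1 - y)) ≤ β * orbitOne β n := by linarith
        exact le_of_mul_le_mul_left this hβ0
      linarith
    rw [Function.iterate_succ_apply', ih hyn, orbitOne_succ]
    rw [orbitOne_succ] at hy'
    unfold betaMap at hy' ⊢
    have e : β * (orbitOne β n - β ^ n * (1 - y)) =
        β * orbitOne β n - β ^ (n + 1) * (1 - y) := by ring
    -- `β T^n(1)` is lowered by at most its fractional part, so the digit does not change.
    have hfloor : ⌊β * (orbitOne β n - β ^ n * (1 - y))⌋ = ⌊β * orbitOne β n⌋ := by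
      rw [Int.floor_eq_iff, e]
      constructor
      · linarith
      · linarith [Int.lt_floor_add_one (β * orbitOne β n)]
    rw [hfloor, e]
    ring

/-- The last cylinder of rank `n`, `[1 - β^{-n} T^n(1), 1[`, splits into `dₙ` full cylinders of rank
`n+1` followed by the last cylinder of rank `n+1`. These last cylinders shrink to `1`, so `x` leaves
them at some rank, and at that moment it falls into a full one. -/
theorem exists_fullCylinder_succ (hβ : 1 < β) {x : ℝ} (hx : x ∈ Set.Ico (0 : ℝ) 1) :
    ∃ n l, IsFullCylinder β (n + 1) l ∧ x ∈ Set.Ico l (l + (β ^ (n + 1))⁻¹) := by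
  have hβ0 : 0 < β := by linarith
  have hlim : Tendsto (fun n : ℕ => (β ^ n)⁻¹ * orbitOne β n) atTop (𝓝 0) :=
    (summable_inv_pow_mul_orbitOne hβ).tendsto_atTop_zero
  have hex : ∃ n, (β ^ n)⁻¹ * orbitOne β n < 1 - x :=
    (hlim.eventually (gt_mem_nhds (by linarith [hx.2] : (0 : ℝ) < 1 - x))).exists
  classical
  obtain ⟨n, hn, hn'⟩ : ∃ n, 1 - x ≤ (β ^ n)⁻¹ * orbitOne β n ∧
      (β ^ (n + 1))⁻¹ * orbitOne β (n + 1) < 1 - x := by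
    have h0 : Nat.find hex ≠ 0 := by
      intro h
      have := Nat.find_spec hex
      rw [h] at this
      simp [orbitOne_zero] at this
      linarith [hx.1]
    obtain ⟨n, hn⟩ := Nat.exists_eq_succ_of_ne_zero h0
    refine ⟨n, not_lt.1 (Nat.find_min hex (by omega)), ?_⟩
    have := Nat.find_spec hex
    rwa [hn] at this
  have hp : 0 < β ^ n := by positivity
  have hq : 0 < β ^ (n + 1) := by positivity
  set s : ℝ := 1 - (β ^ n)⁻¹ * orbitOne β n with hs
  have hs0 : 0 ≤ s := by
    have h1 : (β ^ n)⁻¹ ≤ 1 := inv_le_one_of_one_le₀ (one_le_pow₀ hβ.le)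
    have : (β ^ n)⁻¹ * orbitOne β n ≤ 1 :=
      mul_le_one₀ h1 (orbitOne_mem_Icc β n).1 (orbitOne_mem_Icc β n).2
    linarith
  have hsn : β ^ (n + 1) * (1 - s) = β * orbitOne β n := by
    rw [hs, pow_succ]
    field_simp
    ring
  have hxs : 0 ≤ β ^ (n + 1) * (x - s) := mul_nonneg hq.le (by linarith)
  have hj0 : (0 : ℝ) ≤ ⌊β ^ (n + 1) * (x - s)⌋ := by exact_mod_cast Int.floor_nonneg.2 hxs
  have hjle := Int.floor_le (β ^ (n + 1) * (x - s))
  have hjlt := Int.lt_floor_add_one (β ^ (n + 1) * (x - s))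
  -- The next last cylinder starts at `s + dₙ β^{-n-1}` and `x` lies to its left, so the piece
  -- containing `x` has index less than `dₙ`.
  have hjd : (⌊β ^ (n + 1) * (x - s)⌋ : ℝ) + 1 ≤ ⌊β * orbitOne β n⌋ := by
    have h1 : orbitOne β (n + 1) < β ^ (n + 1) * (1 - x) := by rwa [inv_mul_lt_iff₀ hq] at hn'
    rw [orbitOne_succ, betaMap] at h1
    have h2 : β ^ (n + 1) * (x - s) < ⌊β * orbitOne β n⌋ := by
      have : β ^ (n + 1) * (x - s) = β ^ (n + 1) * (1 - s) - β ^ (n + 1) * (1 - x) := by ring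
      linarith
    have : ⌊β ^ (n + 1) * (x - s)⌋ < ⌊β * orbitOne β n⌋ := by
      exact_mod_cast hjle.trans_lt h2
    exact_mod_cast this
  set j : ℤ := ⌊β ^ (n + 1) * (x - s)⌋
  have hmul : β ^ (n + 1) * ((β ^ (n + 1))⁻¹ * j) = j := mul_inv_cancel_left₀ hq.ne' _
  have hend : s + (β ^ (n + 1))⁻¹ * j + (β ^ (n + 1))⁻¹ = s + (β ^ (n + 1))⁻¹ * (j + 1) := by
    ring
  have hle1 : s + (β ^ (n + 1))⁻¹ * (j + 1) ≤ 1 := by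
    have : (β ^ (n + 1))⁻¹ * ((j : ℝ) + 1) ≤ 1 - s := by
      rw [inv_mul_le_iff₀ hq, hsn]
      exact hjd.trans (Int.floor_le _)
    linarith
  have hnn : 0 ≤ (β ^ (n + 1))⁻¹ * (j : ℝ) := mul_nonneg (by positivity) hj0
  have key : ∀ y ∈ Set.Ico (s + (β ^ (n + 1))⁻¹ * j) (s + (β ^ (n + 1))⁻¹ * (j + 1)),
      j ≤ β ^ (n + 1) * (y - s) ∧ β ^ (n + 1) * (y - s) < j + 1 := by
    rintro y ⟨h1, h2⟩
    constructor
    · rw [← inv_mul_le_iff₀ hq]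
      linarith
    · rw [← lt_inv_mul_iff₀ hq]
      linarith
  refine ⟨n, s + (β ^ (n + 1))⁻¹ * j, ⟨by positivity, by rwa [hend], ?_⟩, ?_, ?_⟩
  · intro y hy
    rw [hend] at hy
    obtain ⟨h1, h2⟩ := key y hy
    rw [Function.iterate_succ_apply', betaMap_iterate_eq_of_near_one hβ n (by linarith [hy.1])
      (by linarith [hy.2])]
    have e : β * (orbitOne β n - β ^ n * (1 - y)) = β ^ (n + 1) * (y - s) := by
      rw [mul_sub, ← hsn]
      ring
    rw [betaMap, e, Int.floor_eq_iff.2 ⟨h1, h2⟩]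
    rw [← sub_sub, mul_sub _ (y - s), hmul]
  · have : (β ^ (n + 1))⁻¹ * (j : ℝ) ≤ x - s := by rwa [inv_mul_le_iff₀ hq]
    linarith
  · rw [hend]
    have : x - s < (β ^ (n + 1))⁻¹ * ((j : ℝ) + 1) := by rwa [lt_inv_mul_iff₀ hq]
    linarith

/-- Every point of `[0,1[` lies in full cylinders of arbitrarily large rank. -/
theorem exists_fullCylinder_ge (hβ : 1 < β) {x : ℝ} (hx : x ∈ Set.Ico (0 : ℝ) 1) (N : ℕ) :
    ∃ n l, N ≤ n ∧ IsFullCylinder β n l ∧ x ∈ Set.Ico l (l + (β ^ n)⁻¹) := by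
  induction N with
  | zero =>
    obtain ⟨n, l, h⟩ := exists_fullCylinder_succ hβ hx
    exact ⟨n + 1, l, Nat.zero_le _, h⟩
  | succ N ih =>
    obtain ⟨n, l, hn, hl, hxl⟩ := ih
    -- A full cylinder around the image `T^n x` pulls back to a full cylinder of larger rank around
    -- `x`.
    obtain ⟨m, k, hk, hxk⟩ := exists_fullCylinder_succ hβ (pow_mul_sub_mem_Ico hβ hxl)
    have hp : 0 < β ^ n := by positivity
    refine ⟨m + 1 + n, l + (β ^ n)⁻¹ * k, by omega, hl.comp hβ hk, ?_, ?_⟩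
    · have := (inv_mul_le_iff₀ hp).2 hxk.1
      linarith
    · have := (lt_inv_mul_iff₀ hp).2 hxk.2
      have e : (β ^ n)⁻¹ * (k + (β ^ (m + 1))⁻¹) =
          (β ^ n)⁻¹ * k + (β ^ (m + 1 + n))⁻¹ := by
        rw [mul_add, pow_add _ (m + 1), mul_inv, mul_comm (β ^ (m + 1))⁻¹]
      linarith

end FullCylinders

/-! ### Invariance of the Parry measure -/

section Invariance

variable {β : ℝ}

theorem parryMeasure_preimage_coe {B : Set ℝ} (hB : MeasurableSet B) :
    parryMeasure β (Subtype.val ⁻¹' B) =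
      ∫⁻ x in Set.Ico (0 : ℝ) 1,
        B.indicator (fun y => ENNReal.ofReal (parryDensity β y)) x := by
  have hB' : MeasurableSet ((Subtype.val : Set.Ico (0 : ℝ) 1 → ℝ) ⁻¹' B) :=
    measurable_subtype_coe hB
  rw [parryMeasure, withDensity_apply _ hB', ← lintegral_indicator hB',
    ← lintegral_subtype_comap measurableSet_Ico]
  rfl

theorem lintegral_Ico_natCast (f : ℝ → ENNReal) (N : ℕ) :
    ∫⁻ x in Set.Ico (0 : ℝ) N, f x =
      ∑ a ∈ Finset.range N, ∫⁻ x in Set.Ico (0 : ℝ) 1, f (x + a) := by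
  induction N with
  | zero => simp
  | succ N ih =>
    have hN : (0 : ℝ) ≤ N := N.cast_nonneg
    have hunion : Set.Ico (0 : ℝ) (N + 1 : ℕ) = Set.Ico 0 (N : ℝ) ∪ Set.Ico (N : ℝ) (N + 1) := by
      push_cast
      exact (Set.Ico_union_Ico_eq_Ico hN (by linarith)).symm
    have hdisj : Disjoint (Set.Ico 0 (N : ℝ)) (Set.Ico (N : ℝ) (N + 1)) :=
      Set.Ico_disjoint_Ico_same
    rw [hunion, lintegral_union measurableSet_Ico hdisj, ih, Finset.sum_range_succ]
    congr 1
    rw [← lintegral_indicator measurableSet_Ico, ← lintegral_indicator measurableSet_Ico,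
      ← lintegral_add_right_eq_self _ (N : ℝ)]
    congr 1
    ext x
    by_cases hx : x ∈ Set.Ico (0 : ℝ) 1
    · have hx' : x + N ∈ Set.Ico (N : ℝ) (N + 1) := ⟨by linarith [hx.1], by linarith [hx.2]⟩
      simp only [Set.indicator_of_mem hx, Set.indicator_of_mem hx']
    · have hx' : x + N ∉ Set.Ico (N : ℝ) (N + 1) :=
        fun h => hx ⟨by linarith [h.1], by linarith [h.2]⟩
      simp only [Set.indicator_of_notMem hx, Set.indicator_of_notMem hx']

/-- Change of variables along the inverse branches `x ↦ (x + a) / β`. -/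
theorem lintegral_Ico_eq_sum_branches (hβ : 1 < β) {f : ℝ → ENNReal} (hf : Measurable f) :
    ∫⁻ x in Set.Ico (0 : ℝ) 1, f x =
      ENNReal.ofReal β⁻¹ * ∑ a ∈ Finset.range (⌊β⌋₊ + 1),
        ∫⁻ x in Set.Ico (0 : ℝ) 1, (Set.Ico (0 : ℝ) 1).indicator f ((x + a) / β) := by
  have hβ0 : 0 < β := by linarith
  have hg : Measurable ((Set.Ico (0 : ℝ) 1).indicator f) := hf.indicator measurableSet_Ico
  rw [← lintegral_Ico_natCast (fun y => (Set.Ico (0 : ℝ) 1).indicator f (y / β)),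
    ← lintegral_indicator measurableSet_Ico, ← lintegral_indicator measurableSet_Ico]
  have hsupp : (Set.Ico (0 : ℝ) (⌊β⌋₊ + 1 : ℕ)).indicator
      (fun y => (Set.Ico (0 : ℝ) 1).indicator f (y / β)) =
      fun y => (Set.Ico (0 : ℝ) 1).indicator f (β⁻¹ * y) := by
    ext y
    rw [← div_eq_inv_mul]
    by_cases hy : y ∈ Set.Ico (0 : ℝ) (⌊β⌋₊ + 1 : ℕ)
    · rw [Set.indicator_of_mem hy]
    · rw [Set.indicator_of_notMem hy, Set.indicator_of_notMem]
      rintro ⟨h0, h1⟩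
      rw [div_lt_one hβ0] at h1
      rw [le_div_iff₀ hβ0, zero_mul] at h0
      refine hy ⟨h0, ?_⟩
      push_cast
      exact h1.trans (Nat.lt_floor_add_one β)
  rw [hsupp, ← lintegral_map hg (measurable_const_mul β⁻¹)]
  conv_lhs => rw [← Real.smul_map_volume_mul_left (inv_ne_zero hβ0.ne')]
  rw [lintegral_smul_measure, abs_of_pos (inv_pos.2 hβ0), smul_eq_mul]

theorem betaMap_branch (hβ : 1 < β) {x : ℝ} (hx : x ∈ Set.Ico (0 : ℝ) 1) (a : ℕ) :
    betaMap β ((x + a) / β) = x := by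
  have hβ0 : β ≠ 0 := by positivity
  have hfl : ⌊x + a⌋ = (a : ℤ) := by
    rw [Int.floor_eq_iff]
    push_cast
    exact ⟨by linarith [hx.1], by linarith [hx.2]⟩
  rw [betaMap, mul_div_cancel₀ _ hβ0, hfl]
  push_cast
  ring

theorem measurePreserving_T (hβ : 1 < β) :
    MeasurePreserving (T β) (parryMeasure β) (parryMeasure β) := by
  refine ⟨measurable_T β, Measure.ext fun s hs => ?_⟩
  obtain ⟨B, hB, rfl⟩ := hs
  have hβ0 : 0 < β := by linarith
  have hh := measurable_ofReal_parryDensity hβ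
  have hpre : T β ⁻¹' (Subtype.val ⁻¹' B) = Subtype.val ⁻¹' (betaMap β ⁻¹' B) := rfl
  have hpB : MeasurableSet (betaMap β ⁻¹' B) := measurable_betaMap β hB
  rw [Measure.map_apply (measurable_T β) (measurable_subtype_coe hB), hpre,
    parryMeasure_preimage_coe hB, parryMeasure_preimage_coe hpB,
    lintegral_Ico_eq_sum_branches hβ (hh.indicator hpB)]
  rw [← lintegral_finsetSum _ fun a _ => by
      exact ((hh.indicator hpB).indicator measurableSet_Ico).comp (by fun_prop),
    ← lintegral_const_mul' _ _ ENNReal.ofReal_ne_top]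
  refine setLIntegral_congr_fun measurableSet_Ico fun x hx => ?_
  -- Every branch point `(x + a) / β` is mapped to `x`, so the preimage of `B` contains all of them
  -- or none: the sum is `P_β h_β(x)` or `0`.
  by_cases hxB : x ∈ B
  · have hterm : ∀ a : ℕ, (Set.Ico (0 : ℝ) 1).indicator ((betaMap β ⁻¹' B).indicator
        fun y => ENNReal.ofReal (parryDensity β y)) ((x + a) / β) =
        ENNReal.ofReal (parryDensity β ((x + a) / β) *
          (Set.Ico (0 : ℝ) 1).indicator (fun _ => (1 : ℝ)) ((x + a) / β)) := by
      intro a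
      have hmem : (x + a) / β ∈ betaMap β ⁻¹' B := by
        rwa [Set.mem_preimage, betaMap_branch hβ hx]
      by_cases h : (x + a) / β ∈ Set.Ico (0 : ℝ) 1
      · rw [Set.indicator_of_mem h, Set.indicator_of_mem h, Set.indicator_of_mem hmem, mul_one]
      · rw [Set.indicator_of_notMem h, Set.indicator_of_notMem h, mul_zero, ENNReal.ofReal_zero]
    simp only [hterm]
    rw [Set.indicator_of_mem hxB, ← ENNReal.ofReal_sum_of_nonneg fun a _ =>
        mul_nonneg (parryDensity_nonneg hβ _) (Set.indicator_nonneg (fun _ _ => zero_le_one) _),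
      ← ENNReal.ofReal_mul (inv_pos.2 hβ0).le, ← one_div]
    exact congrArg ENNReal.ofReal (perronFrobenius_parryDensity hβ hx)
  · have hterm : ∀ a : ℕ, (Set.Ico (0 : ℝ) 1).indicator ((betaMap β ⁻¹' B).indicator
        fun y => ENNReal.ofReal (parryDensity β y)) ((x + a) / β) = 0 := by
      intro a
      have hmem : (x + a) / β ∉ betaMap β ⁻¹' B := by
        rwa [Set.mem_preimage, betaMap_branch hβ hx]
      rw [Set.indicator_apply, Set.indicator_of_notMem hmem, ite_self]
    simp only [hterm]
    rw [Set.indicator_of_notMem hxB]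
    simp

end Invariance

/-! ### Exactness and ergodicity -/

section Exactness

variable {β : ℝ}

/-- A set `T^{-n} B` has in a full cylinder of rank `n` at most the relative measure of `B`. -/
theorem IsFullCylinder.volume_inter_closedBall_div_le (hβ : 1 < β) {n : ℕ} {l : ℝ}
    (hl : IsFullCylinder β n l) (B : Set (Set.Ico (0 : ℝ) 1)) :
    volume (Subtype.val '' ((T β)^[n] ⁻¹' B) ∩
        Metric.closedBall (l + (β ^ n)⁻¹ / 2) ((β ^ n)⁻¹ / 2)) /
      volume (Metric.closedBall (l + (β ^ n)⁻¹ / 2) ((β ^ n)⁻¹ / 2)) ≤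
    volume (Subtype.val '' B : Set ℝ) := by
  have hp : 0 < β ^ n := by positivity
  have hr : 0 < (β ^ n)⁻¹ := inv_pos.2 hp
  -- The closed ball is the cylinder together with its right endpoint, a null set split off here.
  have hsub : Subtype.val '' ((T β)^[n] ⁻¹' B) ∩
      Metric.closedBall (l + (β ^ n)⁻¹ / 2) ((β ^ n)⁻¹ / 2) ⊆
      {l + (β ^ n)⁻¹} ∪ (fun y => β ^ n * y) ⁻¹' ((fun y => -(β ^ n * l) + y) ⁻¹'
        (Subtype.val '' B)) := by
    rintro _ ⟨⟨y, hy, rfl⟩, hyb⟩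
    rw [Real.closedBall_eq_Icc] at hyb
    rcases eq_or_ne (y : ℝ) (l + (β ^ n)⁻¹) with h | h
    · exact Or.inl h
    · refine Or.inr ⟨_, hy, ?_⟩
      rw [coe_T_iterate, hl.iterate_eq]
      · ring
      · exact ⟨by linarith [hyb.1], lt_of_le_of_ne (by linarith [hyb.2]) h⟩
  rw [Real.volume_closedBall, mul_div_cancel₀ _ (two_ne_zero' ℝ)]
  refine ENNReal.div_le_of_le_mul' ?_
  calc _ ≤ _ := measure_mono hsub
    _ ≤ _ := measure_union_le _ _
    _ = _ := by
      rw [Real.volume_singleton, zero_add, Real.volume_preimage_mul_left hp.ne',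
        measure_preimage_add, abs_of_pos hr]

/-- A set `A` that is of the form `T^{-n} Aₙ` for all `n` and has positive Lebesgue measure comes
from sets `Aₙ` of Lebesgue measure arbitrarily close to `1`. -/
theorem exists_tendsto_one_le_volume (hβ : 1 < β) {A : Set (Set.Ico (0 : ℝ) 1)}
    (hA : MeasurableSet A) (hvol : volume (Subtype.val '' A : Set ℝ) ≠ 0)
    {B : ℕ → Set (Set.Ico (0 : ℝ) 1)} (hB : ∀ n, (T β)^[n] ⁻¹' B n = A) :
    ∃ (k : ℕ → ℕ) (q : ℕ → ENNReal), Tendsto q atTop (𝓝 1) ∧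
      ∀ j, q j ≤ volume (Subtype.val '' B (k j) : Set ℝ) := by
  have hA' : MeasurableSet (Subtype.val '' A : Set ℝ) :=
    (MeasurableEmbedding.subtype_coe measurableSet_Ico).measurableSet_image.2 hA
  have hne : (ae ((volume : Measure ℝ).restrict (Subtype.val '' A))).NeBot := by
    rwa [ae_neBot, Ne, Measure.restrict_eq_zero]
  obtain ⟨x, hx, hxA⟩ := ((IsUnifLocDoublingMeasure.ae_tendsto_measure_inter_div
    (volume : Measure ℝ) (Subtype.val '' A) 1).and (ae_restrict_mem hA')).exists
  obtain ⟨x, -, rfl⟩ := hxA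
  choose k l hk hl hxl using exists_fullCylinder_ge hβ x.2
  have hr : ∀ n : ℕ, 0 < (β ^ n)⁻¹ := fun n => by positivity
  -- This form of the density theorem allows balls not centred at `x`, so the closed cylinders
  -- themselves serve; with constant `1`, they need only contain `x`.
  refine ⟨k, _, hx (fun j => l j + (β ^ k j)⁻¹ / 2) (fun j => (β ^ k j)⁻¹ / 2) ?_ ?_, fun j => ?_⟩
  · refine tendsto_nhdsWithin_iff.2 ⟨?_, Eventually.of_forall fun j => half_pos (hr _)⟩
    have := ((tendsto_inv_pow hβ).comp (tendsto_atTop_mono hk tendsto_id)).div_const 2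
    simpa using this
  · refine Eventually.of_forall fun j => ?_
    rw [one_mul, Real.closedBall_eq_Icc]
    exact ⟨by linarith [(hxl j).1], by linarith [(hxl j).2]⟩
  · have := (hl j).volume_inter_closedBall_div_le hβ (B (k j))
    rwa [hB] at this

theorem parryMeasure_le (hβ : 1 < β) :
    parryMeasure β ≤ ENNReal.ofReal (1 / parryConst β * ∑' n : ℕ, (β ^ n)⁻¹) •
      (volume : Measure ℝ).comap (Subtype.val : Set.Ico (0 : ℝ) 1 → ℝ) := by
  rw [← withDensity_const]
  exact withDensity_mono (Eventually.of_forall fun x =>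
    ENNReal.ofReal_le_ofReal (parryDensity_le hβ x))

theorem comap_coe_compl_Ico {B : Set (Set.Ico (0 : ℝ) 1)} (hB : MeasurableSet B) :
    (volume : Measure ℝ).comap Subtype.val Bᶜ = 1 - volume (Subtype.val '' B : Set ℝ) := by
  have hemb := MeasurableEmbedding.subtype_coe (measurableSet_Ico (a := (0 : ℝ)) (b := 1))
  have : IsProbabilityMeasure
      ((volume : Measure ℝ).comap (Subtype.val : Set.Ico (0 : ℝ) 1 → ℝ)) :=
    ⟨by rw [hemb.comap_apply, Set.image_univ, Subtype.range_coe, Real.volume_Ico]; simp⟩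
  rw [prob_compl_eq_one_sub hB, hemb.comap_apply]

theorem isExact_T (hβ : 1 < β) : IsExact (T β) (parryMeasure β) := by
  refine ⟨measurePreserving_T hβ, fun A hA => ?_⟩
  rw [MeasurableSpace.measurableSet_iInf] at hA
  choose B hBm hB using hA
  have hAm : MeasurableSet A := by
    have := hBm 0
    rwa [show B 0 = A from hB 0] at this
  have hemb := MeasurableEmbedding.subtype_coe (measurableSet_Ico (a := (0 : ℝ)) (b := 1))
  by_cases hvol : volume (Subtype.val '' A : Set ℝ) = 0
  · left
    refine withDensity_absolutelyContinuous _ _ ?_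
    rwa [hemb.comap_apply]
  · right
    obtain ⟨k, q, hq, hqB⟩ := exists_tendsto_one_le_volume hβ hAm hvol hB
    set C := ENNReal.ofReal (1 / parryConst β * ∑' n : ℕ, (β ^ n)⁻¹) with hC
    have hlim : Tendsto (fun j => C * (1 - q j)) atTop (𝓝 0) := by
      have := ENNReal.Tendsto.const_mul (a := C)
        (ENNReal.Tendsto.sub (tendsto_const_nhds (x := (1 : ENNReal))) hq
          (Or.inl ENNReal.one_ne_top)) (Or.inr ENNReal.ofReal_ne_top)
      simpa using this
    refine le_antisymm (ge_of_tendsto' hlim fun j => ?_) zero_le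
    calc parryMeasure β Aᶜ = parryMeasure β ((T β)^[k j] ⁻¹' (B (k j))ᶜ) := by
          rw [Set.preimage_compl, hB]
      _ = parryMeasure β (B (k j))ᶜ :=
          ((measurePreserving_T hβ).iterate (k j)).measure_preimage
            (hBm (k j)).compl.nullMeasurableSet
      _ ≤ C * (1 - volume (Subtype.val '' B (k j) : Set ℝ)) := by
          rw [← comap_coe_compl_Ico (hBm (k j))]
          exact parryMeasure_le hβ _
      _ ≤ C * (1 - q j) := mul_le_mul_right (tsub_le_tsub_left (hqB j) 1) C

/-- A strictly invariant measurable set is its own preimage under every iterate, hence belongs to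
the tail σ-algebra. -/
theorem IsExact.ergodic {α : Type*} [MeasurableSpace α] {S : α → α} {μ : Measure α}
    (h : IsExact S μ) : Ergodic S μ := by
  refine { h.measurePreserving with aeconst_set := fun s hs hinv => ?_ }
  have hiter : ∀ n : ℕ, S^[n] ⁻¹' s = s := by
    intro n
    rw [Set.preimage_iterate_eq]
    exact Function.iterate_fixed hinv n
  rw [eventuallyConst_set']
  refine (h.tail_trivial s ?_).imp ae_eq_empty.2 ae_eq_univ.2
  exact MeasurableSpace.measurableSet_iInf.2 fun n => ⟨s, hs, hiter n⟩

end Exactness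

end BetaTransformation

theorem theorem2 (β : ℝ) (hirr : Irrational β) (hβ : 1 < β) :
    -- the series defining the normalizing constant and the density converge
    Summable (fun n : ℕ => (β ^ n)⁻¹ * BetaTransformation.orbitOne β n) ∧
    (∀ x : ℝ, Summable (BetaTransformation.parryTerm β x)) ∧
    -- the measure with density `h_β` is a probability measure
    MeasureTheory.IsProbabilityMeasure (BetaTransformation.parryMeasure β) ∧
    -- the density is fixed by the transfer operator
    (∀ x ∈ Set.Ico (0 : ℝ) 1,
      BetaTransformation.perronFrobenius β (BetaTransformation.parryDensity β) x =
        BetaTransformation.parryDensity β x) ∧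
    -- invariance, exactness, ergodicity
    MeasureTheory.MeasurePreserving (BetaTransformation.T β)
      (BetaTransformation.parryMeasure β) (BetaTransformation.parryMeasure β) ∧
    BetaTransformation.IsExact (BetaTransformation.T β) (BetaTransformation.parryMeasure β) ∧
    Ergodic (BetaTransformation.T β) (BetaTransformation.parryMeasure β) :=
  ⟨BetaTransformation.summable_inv_pow_mul_orbitOne hβ, BetaTransformation.summable_parryTerm hβ,
    BetaTransformation.isProbabilityMeasure_parryMeasure hβ,
    fun _ hx => BetaTransformation.perronFrobenius_parryDensity hβ hx,
    BetaTransformation.measurePreserving_T hβ, BetaTransformation.isExact_T hβ,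
    (BetaTransformation.isExact_T hβ).ergodic⟩
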